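/- Let $R_0,C_0,\alpha,R_1,R_a,C_1>0$, put $a=\frac{R_1+R_a}{R_1R_aC_1}$, $b=\frac{1}{R_aC_1}$, and let $\varphi:\mathbb R\to\mathbb R$ be a continuously differentiable odd function with $\varphi'\ge 0$ such that for every $k>0$ there is $r>0$ with $y\varphi(y)-ky^2>0$ for all $|y|>r$. Consider the op-amp in positive feedback with the $RC$ network, i.e. the system with state $(x,z)\in\mathbb R^2$, input $V_r$ and output $V_0=x$, $$\dot x=-\tfrac{1}{R_0C_0}x-\tfrac1{C_0}\varphi(x)+\tfrac{\alpha}{C_0}(z+V_r),\qquad \dot z=-az+bx .$$ A system $\dot\xi=f(\xi)+Bu$, $y=C\xi$ with $\xi\in\mathbb R^n$ is called strictly $p$-passive from $u$ to $y$ with rate $\lambda\ge0$ if there are a constant symmetric matrix $P$ with $p$ negative, no zero and $n-p$ positive eigenvalues and an $\varepsilon>0$ such that, for all $\xi,\delta\xi,\delta u$, with $\dot{\delta \xi}=\partial f(\xi)\,\delta\xi+B\,\delta u$ and $\delta y=C\,\delta\xi$, $$\begin{bmatrix}\dot{\delta\xi}\\ \delta\xi\end{bmatrix}^{\top}\begin{bmatrix}0&P\\P&2\lambda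 P+\varepsilon I\end{bmatrix}\begin{bmatrix}\dot{\delta\xi}\\ \delta\xi\end{bmatrix}\le\begin{bmatrix}\delta y\\ \delta u\end{bmatrix}^{\top}\begin{bmatrix}0&I\\I&0\end{bmatrix}\begin{bmatrix}\delta y\\ \delta u\end{bmatrix}.$$ Suppose that $\frac1{R_0C_0}>a$. Then: 1. The system is strictly $1$-passive from $V_r$ to $V_0$ with every rate $\lambda\in\left(a,\frac1{R_0C_0}\right)$. 2. For every constant input $V_r\in\mathbb R$, every initial condition admits a trajectory defined on $[0,\infty)$, and every trajectory on $[0,\infty)$ converges, as $t\to\infty$, to a fixed point. 3. Let $V_r=0$ and suppose that $\varphi'(0)<-\frac1{R_0}+\frac{\alpha R_1}{R_1+R_a}$. Then the origin is a saddle (the linearization there has one negative and one positive real eigenvalue), and there are at least two further fixed points $\pm e\neq 0$. If moreover $\varphi$ is stiffening, in the sense that $\varphi'$ is nondecreasing on $[0,\infty)$ (as for $\varphi(y)=\eta\sinh(\beta y)$ with $\eta,\beta>0$), then the circuit is bistable: it has exactly three fixed points, two of which are stable nodes (the linearization has two negative real eigenvalues) and one of which is a saddle. -/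

import Mathlib

open Set Filter Topology

noncomputable section

namespace OpAmp

/-- An open system `ẋ = f x + B u`, `y = C x` with `n` states, `m` inputs and `q` outputs. -/
structure OpenSystem (n m q : ℕ) where
  f : (Fin n → ℝ) → (Fin n → ℝ)
  B : Matrix (Fin n) (Fin m) ℝ
  C : Matrix (Fin q) (Fin n) ℝ

/-- The Jacobian matrix of `f` at `x`. -/
def jacobian {n : ℕ} (f : (Fin n → ℝ) → (Fin n → ℝ)) (x : Fin n → ℝ) :
    Matrix (Fin n) (Fin n) ℝ :=
  LinearMap.toMatrix' (fderiv ℝ f x).toLinearMap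

/-- The numbers of negative, zero and positive eigenvalues (with multiplicity) are `p`, `k`, `q`.
For a symmetric matrix all eigenvalues are real. -/
def HasInertia {n : ℕ} (P : Matrix (Fin n) (Fin n) ℝ) (p k q : ℕ) : Prop :=
  P.charpoly.roots.countP (fun μ => μ < 0) = p ∧
  P.charpoly.roots.countP (fun μ => μ = 0) = k ∧
  P.charpoly.roots.countP (fun μ => 0 < μ) = q

/-- The value at the stacked vector `(v, w)` of the quadratic form of a `2 × 2` block matrix. -/
def blockForm {k l : ℕ} (M : Matrix (Fin k ⊕ Fin l) (Fin k ⊕ Fin l) ℝ)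
    (v : Fin k → ℝ) (w : Fin l → ℝ) : ℝ :=
  dotProduct (Sum.elim v w) (M.mulVec (Sum.elim v w))

namespace OpenSystem

/-- The vector field of the system under the constant input `u`. -/
def field {n m q : ℕ} (S : OpenSystem n m q) (u : Fin m → ℝ) (x : Fin n → ℝ) : Fin n → ℝ :=
  S.f x + S.B.mulVec u

/-- Strict `p`-passivity with rate `lam`, from the input to the output: the prolonged system
`δẋ = ∂f(x) δx + B δu`, `δy = C δx` satisfies the differential dissipation inequality with a
constant symmetric matrix `P` of inertia `(p, 0, n - p)` and some `ε > 0`. -/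
def IsStrictlyPassive {n m : ℕ} (S : OpenSystem n m m) (p : ℕ) (lam : ℝ) : Prop :=
  0 ≤ lam ∧ Differentiable ℝ S.f ∧
  ∃ (P : Matrix (Fin n) (Fin n) ℝ) (ε : ℝ), P.IsSymm ∧ HasInertia P p 0 (n - p) ∧ 0 < ε ∧
    ∀ (x δx : Fin n → ℝ) (δu : Fin m → ℝ),
      blockForm (Matrix.fromBlocks 0 P P ((2 * lam) • P + ε • (1 : Matrix (Fin n) (Fin n) ℝ)))
          ((jacobian S.f x).mulVec δx + S.B.mulVec δu) δx
        ≤ blockForm (Matrix.fromBlocks 0 1 1 0) (S.C.mulVec δx) δu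

end OpenSystem

/-- A forward trajectory (on `[0, ∞)`) of the autonomous vector field `F`. -/
def IsTrajectory {n : ℕ} (F : (Fin n → ℝ) → (Fin n → ℝ)) (γ : ℝ → (Fin n → ℝ)) : Prop :=
  IsIntegralCurveOn γ (fun _ => F) (Ici 0)

/-- A stable node of a planar vector field: an equilibrium whose linearization has two negative
real eigenvalues (counted with multiplicity). -/
def IsStableNode (F : (Fin 2 → ℝ) → (Fin 2 → ℝ)) (e : Fin 2 → ℝ) : Prop :=
  F e = 0 ∧ DifferentiableAt ℝ F e ∧ ∃ μ₁ μ₂ : ℝ, μ₁ < 0 ∧ μ₂ < 0 ∧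
    (jacobian F e).charpoly.roots = {μ₁, μ₂}

/-- A saddle of a planar vector field: an equilibrium whose linearization has one negative and
one positive real eigenvalue. -/
def IsSaddle (F : (Fin 2 → ℝ) → (Fin 2 → ℝ)) (e : Fin 2 → ℝ) : Prop :=
  F e = 0 ∧ DifferentiableAt ℝ F e ∧ ∃ μ₁ μ₂ : ℝ, μ₁ < 0 ∧ 0 < μ₂ ∧
    (jacobian F e).charpoly.roots = {μ₁, μ₂}

/-- Exactly three equilibria: two stable nodes and a saddle. -/
def IsBistable (F : (Fin 2 → ℝ) → (Fin 2 → ℝ)) : Prop :=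
  ∃ e₁ e₂ s : Fin 2 → ℝ, e₁ ≠ e₂ ∧ e₁ ≠ s ∧ e₂ ≠ s ∧ {e | F e = 0} = {e₁, e₂, s} ∧
    IsStableNode F e₁ ∧ IsStableNode F e₂ ∧ IsSaddle F s

/-- The standing assumption on the static nonlinearity. -/
structure IsSaturation (φ : ℝ → ℝ) : Prop where
  contDiff : ContDiff ℝ 1 φ
  odd : ∀ y, φ (-y) = -φ y
  deriv_nonneg : ∀ y, 0 ≤ deriv φ y
  dominates : ∀ k > 0, ∃ r > 0, ∀ y, r < |y| → 0 < y * φ y - k * y ^ 2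

/-- The nonlinearity is stiffening: its slope does not decrease as the amplitude grows. (As `φ` is
odd, it suffices to say so for nonnegative arguments.) -/
def IsStiffening (φ : ℝ → ℝ) : Prop :=
  MonotoneOn (deriv φ) (Ici 0)

/-- Component values of the op-amp (`R₀, C₀, α`) and of the `RC` network (`R₁, Ra, C₁`). -/
structure Params where
  R₀ : ℝ
  C₀ : ℝ
  α : ℝ
  R₁ : ℝ
  Ra : ℝ
  C₁ : ℝ
  R₀_pos : 0 < R₀
  C₀_pos : 0 < C₀
  α_pos : 0 < α
  R₁_pos : 0 < R₁
  Ra_pos : 0 < Ra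
  C₁_pos : 0 < C₁

namespace Params

/-- The pole parameter of the `RC` network. -/
def a (c : Params) : ℝ := (c.R₁ + c.Ra) / (c.R₁ * c.Ra * c.C₁)

/-- The input gain of the `RC` network. -/
def b (c : Params) : ℝ := 1 / (c.Ra * c.C₁)

/-- The op-amp: `ẋ = -x / (R₀ C₀) - φ x / C₀ + (α / C₀) V_E`, with output `V₀ = x`. -/
def opAmpRate (c : Params) (φ : ℝ → ℝ) (x VE : ℝ) : ℝ :=
  -(1 / (c.R₀ * c.C₀)) * x - 1 / c.C₀ * φ x + c.α / c.C₀ * VE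

/-- The `RC` network: `ż = -a z + b u`, with output `z`. -/
def networkRate (c : Params) (z u : ℝ) : ℝ := -c.a * z + c.b * u

/-- The op-amp in positive feedback with the `RC` network, `V_E = z + V_r` and `u = V₀`, as an open
system with state `(x, z)`, input `V_r` and output `V₀ = x`. -/
def closedLoop (c : Params) (φ : ℝ → ℝ) : OpenSystem 2 1 1 where
  f := fun s => ![c.opAmpRate φ (s 0) (s 1), c.networkRate (s 1) (s 0)]
  B := !![c.α / c.C₀; 0]
  C := !![1, 0]

theorem closedLoop_field (c : Params) (φ : ℝ → ℝ) (Vr : ℝ) (s : Fin 2 → ℝ) :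
    (c.closedLoop φ).field ![Vr] s =
      ![c.opAmpRate φ (s 0) (s 1 + Vr), c.networkRate (s 1) (s 0)] := by
  ext i
  fin_cases i
  · simp [OpenSystem.field, closedLoop, opAmpRate]
    ring
  · simp [OpenSystem.field, closedLoop]

end Params

end OpAmp

end

open scoped NNReal

namespace OpAmp

/-- A bounded, globally Lipschitz vector field has an integral curve on `[0, ∞)` through every
initial point. -/
theorem exists_isIntegralCurveOn_Ici {E : Type*} [NormedAddCommGroup E] [NormedSpace ℝ E]
    [CompleteSpace E] {G : E → E} {K L : ℝ≥0} (hK : LipschitzWith K G) (hL : ∀ x, ‖G x‖ ≤ L)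
    (x₀ : E) : ∃ γ : ℝ → E, γ 0 = x₀ ∧ IsIntegralCurveOn γ (fun _ => G) (Ici 0) := by
  have hex : ∀ T : ℝ≥0, ∃ α : ℝ → E, α 0 = x₀ ∧
      ∀ t ∈ Icc (0 : ℝ) T, HasDerivWithinAt α (G (α t)) (Icc (0 : ℝ) T) t := by
    intro T
    have hPL : IsPicardLindelof (fun _ => G) (⟨0, le_rfl, T.2⟩ : Icc (0 : ℝ) T) x₀ (L * T) 0 L K :=
      .of_time_independent (fun x _ => hL x) hK.lipschitzOnWith (by simp)
    exact hPL.exists_eq_forall_mem_Icc_hasDerivWithinAt₀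
  choose α hα₀ hα using hex
  have hagree : ∀ S T : ℝ≥0, S ≤ T → EqOn (α S) (α T) (Icc 0 S) := by
    intro S T hST
    have hsub : Icc (0 : ℝ) S ⊆ Icc (0 : ℝ) T := Icc_subset_Icc_right hST
    have hright : ∀ T : ℝ≥0, ∀ t ∈ Ico (0 : ℝ) T, HasDerivWithinAt (α T) (G (α T t)) (Ici t) t := by
      intro T t ht
      exact ((hα T t (Ico_subset_Icc_self ht)).mono
        (Icc_subset_Icc_left ht.1)).mono_of_mem_nhdsWithin (Icc_mem_nhdsGE ht.2)
    exact ODE_solution_unique (v := fun _ => G) (fun _ => hK)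
      (fun t ht => (hα S t ht).continuousWithinAt) (hright S)
      (fun t ht => ((hα T t (hsub ht)).mono hsub).continuousWithinAt)
      (fun t ht => hright T t ⟨ht.1, ht.2.trans_le hST⟩) (by rw [hα₀, hα₀])
  refine ⟨fun t => α (t.toNNReal + 1) t, hα₀ _, fun t ht => ?_⟩
  have ht' : (0 : ℝ) ≤ t := ht
  set T : ℝ≥0 := t.toNNReal + 1 with hT
  have hTt : (T : ℝ) = t + 1 := by simp [hT, ht']
  have hmem : t ∈ Icc (0 : ℝ) T := ⟨ht', by rw [hTt]; linarith⟩
  have hd : HasDerivWithinAt (α T) (G (α T t)) (Ici 0) t := by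
    refine (hα T t hmem).mono_of_mem_nhdsWithin ?_
    filter_upwards [self_mem_nhdsWithin,
      mem_nhdsWithin_of_mem_nhds (Iio_mem_nhds (show t < T by rw [hTt]; linarith))] with s hs hs'
    exact ⟨hs, le_of_lt hs'⟩
  refine hd.congr_of_eventuallyEq ?_ rfl
  filter_upwards [self_mem_nhdsWithin,
    mem_nhdsWithin_of_mem_nhds (Iio_mem_nhds (show t < T by rw [hTt]; linarith))] with s hs hs'
  have hs0 : (0 : ℝ) ≤ s := hs
  have hsT : ((s.toNNReal + 1 : ℝ≥0) : ℝ) = s + 1 := by simp [hs0]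
  rcases le_total (s.toNNReal + 1) T with h | h
  · exact hagree _ _ h ⟨hs0, by rw [hsT]; linarith⟩
  · exact (hagree _ _ h ⟨hs0, le_of_lt hs'⟩).symm

/-- If a function and its derivative both converge at infinity, the derivative tends to zero. -/
theorem eq_zero_of_tendsto_of_tendsto_deriv {f f' : ℝ → ℝ} {l m : ℝ}
    (hf : ∀ t ∈ Ici (0 : ℝ), HasDerivWithinAt f (f' t) (Ici 0) t)
    (hl : Tendsto f atTop (𝓝 l)) (hm : Tendsto f' atTop (𝓝 m)) : m = 0 := by
  have hslope : ∀ n : ℕ, ∃ ξ ∈ Ioo (n : ℝ) (n + 1), f' ξ = f (n + 1) - f n := by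
    intro n
    have hn : (0 : ℝ) ≤ n := n.cast_nonneg
    obtain ⟨ξ, hξ, h⟩ := exists_hasDerivAt_eq_slope f f' (show (n : ℝ) < n + 1 by linarith)
      (fun t ht => ((hf t (hn.trans ht.1)).mono
        (fun s hs => hn.trans hs.1)).continuousWithinAt)
      (fun t ht => (hf t (hn.trans ht.1.le)).hasDerivAt (Ici_mem_nhds (hn.trans_lt ht.1)))
    exact ⟨ξ, hξ, by simpa using h⟩
  choose ξ hξ hslope using hslope
  have hξ_top : Tendsto ξ atTop atTop :=
    tendsto_atTop_mono (fun n => (hξ n).1.le) tendsto_natCast_atTop_atTop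
  have h₁ : Tendsto (fun n => f' (ξ n)) atTop (𝓝 m) := hm.comp hξ_top
  have h₂ : Tendsto (fun n : ℕ => f ((n : ℝ) + 1) - f n) atTop (𝓝 (l - l)) :=
    (hl.comp (tendsto_atTop_add_const_right _ _ tendsto_natCast_atTop_atTop)).sub
      (hl.comp tendsto_natCast_atTop_atTop)
  simp_rw [hslope] at h₁
  rw [sub_self] at h₂
  exact tendsto_nhds_unique h₁ h₂

theorem monotoneOn_Ici_of_deriv_nonneg {f f' : ℝ → ℝ} {t₀ : ℝ} (ht₀ : 0 ≤ t₀)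
    (hf : ∀ t ∈ Ici (0 : ℝ), HasDerivWithinAt f (f' t) (Ici 0) t)
    (hnn : ∀ t, t₀ ≤ t → 0 ≤ f' t) : MonotoneOn f (Ici t₀) := by
  refine monotoneOn_of_hasDerivWithinAt_nonneg (f' := f') (convex_Ici _)
    (fun t ht => ((hf t (ht₀.trans ht)).mono (Ici_subset_Ici.2 ht₀)).continuousWithinAt) ?_ ?_
  · intro t ht
    exact (hf t (ht₀.trans (interior_subset ht))).mono
      (interior_subset.trans (Ici_subset_Ici.2 ht₀))
  · intro t ht
    exact hnn t (interior_subset ht)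

/-- A bounded function whose derivative eventually has constant sign converges. -/
theorem exists_tendsto_of_deriv_sign {f f' : ℝ → ℝ} {t₀ M : ℝ} (ht₀ : 0 ≤ t₀)
    (hf : ∀ t ∈ Ici (0 : ℝ), HasDerivWithinAt f (f' t) (Ici 0) t)
    (hM : ∀ t, 0 ≤ t → |f t| ≤ M)
    (hsign : (∀ t, t₀ ≤ t → 0 ≤ f' t) ∨ ∀ t, t₀ ≤ t → f' t ≤ 0) :
    ∃ l, Tendsto f atTop (𝓝 l) := by
  wlog hnn : ∀ t, t₀ ≤ t → 0 ≤ f' t generalizing f f'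
  · have hnp := hsign.resolve_left hnn
    obtain ⟨l, hl⟩ := this (f := fun t => -f t) (f' := fun t => -f' t)
      (fun t ht => (hf t ht).neg) (fun t ht => by simpa using hM t ht)
      (.inl fun t ht => neg_nonneg.2 (hnp t ht)) (fun t ht => neg_nonneg.2 (hnp t ht))
    exact ⟨-l, by simpa using hl.neg⟩
  have hmono := monotoneOn_Ici_of_deriv_nonneg ht₀ hf hnn
  have hg : Monotone fun t => f (max t t₀) := fun s t hst =>
    hmono (mem_Ici.2 (le_max_right _ _)) (mem_Ici.2 (le_max_right _ _)) (max_le_max_right _ hst)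
  have hbdd : BddAbove (range fun t => f (max t t₀)) := by
    refine ⟨M, ?_⟩
    rintro _ ⟨t, rfl⟩
    exact (le_abs_self _).trans (hM _ (ht₀.trans (le_max_right _ _)))
  refine ⟨_, (tendsto_atTop_ciSup hg hbdd).congr' ?_⟩
  filter_upwards [eventually_ge_atTop t₀] with t ht
  rw [max_eq_left ht]

/-- A continuous function without zeros on a half-line has constant sign there. -/
theorem pos_or_neg_of_ne_zero {u : ℝ → ℝ} {t₀ : ℝ} (hu : ContinuousOn u (Ici t₀))
    (hne : ∀ t, t₀ ≤ t → u t ≠ 0) :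
    (∀ t, t₀ ≤ t → 0 < u t) ∨ ∀ t, t₀ ≤ t → u t < 0 := by
  by_contra! h
  obtain ⟨⟨s, hs, hus⟩, ⟨t, ht, hut⟩⟩ := h
  obtain ⟨r, hr, hr0⟩ := isPreconnected_Ici.intermediate_value (s := Ici t₀) hs ht hu ⟨hus, hut⟩
  exact hne r hr hr0

/-- A linear planar nonautonomous system with positive off-diagonal coefficients: both components of
a solution eventually have constant sign. -/
theorem exists_eventually_sign_of_cooperative {u v p : ℝ → ℝ} {a b k : ℝ} (hb : 0 < b) (hk : 0 < k)
    (hp : ContinuousOn p (Ici 0))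
    (hu : ∀ t ∈ Ici (0 : ℝ), HasDerivWithinAt u (-p t * u t + k * v t) (Ici 0) t)
    (hv : ∀ t ∈ Ici (0 : ℝ), HasDerivWithinAt v (-a * v t + b * u t) (Ici 0) t) :
    ∃ t₀, 0 ≤ t₀ ∧ ((∀ t, t₀ ≤ t → 0 ≤ u t) ∨ ∀ t, t₀ ≤ t → u t ≤ 0) ∧
      ((∀ t, t₀ ≤ t → 0 ≤ v t) ∨ ∀ t, t₀ ≤ t → v t ≤ 0) := by
  have hne : ∀ t₀, 0 ≤ t₀ → (∀ t, t₀ ≤ t → u t * v t ≠ 0) → ∃ t₀, 0 ≤ t₀ ∧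
      ((∀ t, t₀ ≤ t → 0 ≤ u t) ∨ ∀ t, t₀ ≤ t → u t ≤ 0) ∧
      ((∀ t, t₀ ≤ t → 0 ≤ v t) ∨ ∀ t, t₀ ≤ t → v t ≤ 0) := by
    intro t₀ ht₀ h
    have hsub : Ici t₀ ⊆ Ici (0 : ℝ) := Ici_subset_Ici.2 ht₀
    have huc : ContinuousOn u (Ici t₀) := fun t ht =>
      ((hu t (hsub ht)).mono hsub).continuousWithinAt
    have hvc : ContinuousOn v (Ici t₀) := fun t ht =>
      ((hv t (hsub ht)).mono hsub).continuousWithinAt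
    refine ⟨t₀, ht₀, ?_, ?_⟩
    · exact (pos_or_neg_of_ne_zero huc fun t ht => left_ne_zero_of_mul (h t ht)).imp
        (fun h t ht => (h t ht).le) (fun h t ht => (h t ht).le)
    · exact (pos_or_neg_of_ne_zero hvc fun t ht => right_ne_zero_of_mul (h t ht)).imp
        (fun h t ht => (h t ht).le) (fun h t ht => (h t ht).le)
  have hqc : Continuous fun t => p (max t 0) + a :=
    (hp.comp_continuous (continuous_id.max continuous_const) fun t => mem_Ici.2 (le_max_right _ _)).add
      continuous_const
  set I : ℝ → ℝ := fun t => ∫ s in (0 : ℝ)..t, (p (max s 0) + a) with hI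
  have hId : ∀ t, 0 ≤ t → HasDerivAt I (p t + a) t := by
    intro t ht
    have := hqc.integral_hasStrictDerivAt 0 t
    rw [max_eq_left ht] at this
    exact this.hasDerivAt
  set w : ℝ → ℝ := fun t => Real.exp (I t) * (u t * v t) with hw
  have hwd : ∀ t ∈ Ici (0 : ℝ), HasDerivWithinAt w
      (Real.exp (I t) * (k * v t ^ 2 + b * u t ^ 2)) (Ici 0) t := by
    intro t ht
    refine (((hId t ht).exp.hasDerivWithinAt).mul ((hu t ht).mul (hv t ht))).congr_deriv ?_
    rw [Pi.mul_apply]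
    ring
  have hmono : MonotoneOn w (Ici 0) :=
    monotoneOn_Ici_of_deriv_nonneg le_rfl hwd fun t _ => by positivity
  by_cases hpos : ∃ t₀, 0 ≤ t₀ ∧ 0 < u t₀ * v t₀
  · obtain ⟨t₀, ht₀, h⟩ := hpos
    refine hne t₀ ht₀ fun t ht h0 => ?_
    have h1 : w t₀ ≤ w t := hmono ht₀ (ht₀.trans ht) ht
    have h2 : 0 < w t₀ := mul_pos (Real.exp_pos _) h
    have h3 : w t = 0 := by simp only [hw, h0, mul_zero]
    linarith
  push Not at hpos
  by_cases hneg : ∀ t, 0 ≤ t → u t * v t ≠ 0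
  · exact hne 0 le_rfl hneg
  push Not at hneg
  obtain ⟨t₀, ht₀, h0⟩ := hneg
  have hwz : ∀ t, t₀ ≤ t → w t = 0 := by
    intro t ht
    have h1 : w t₀ ≤ w t := hmono ht₀ (ht₀.trans ht) ht
    have h3 : w t₀ = 0 := by simp only [hw, h0, mul_zero]
    have h2 : w t ≤ 0 := mul_nonpos_of_nonneg_of_nonpos (Real.exp_pos _).le (hpos t (ht₀.trans ht))
    linarith
  have hz : ∀ t, t₀ ≤ t → u t = 0 ∧ v t = 0 := by
    intro t ht
    have hsub : Ici t ⊆ Ici (0 : ℝ) := Ici_subset_Ici.2 (ht₀.trans ht)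
    have h1 := (hwd t (ht₀.trans ht)).mono hsub
    have h2 : HasDerivWithinAt w 0 (Ici t) t :=
      (hasDerivWithinAt_const t (Ici t) (0 : ℝ)).congr (fun s hs => hwz s (ht.trans hs)) (hwz t ht)
    have h3 := (uniqueDiffOn_Ici t t self_mem_Ici).eq_deriv _ h1 h2
    have h4 : k * v t ^ 2 + b * u t ^ 2 = 0 :=
      (mul_eq_zero.1 h3).resolve_left (Real.exp_pos _).ne'
    have h5 : 0 ≤ k * v t ^ 2 := by positivity
    have h6 : 0 ≤ b * u t ^ 2 := by positivity
    have h7 : k * v t ^ 2 = 0 := by linarith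
    have h8 : b * u t ^ 2 = 0 := by linarith
    exact ⟨by simpa [hb.ne'] using h8, by simpa [hk.ne'] using h7⟩
  exact ⟨t₀, ht₀, .inl fun t ht => (hz t ht).1.ge, .inl fun t ht => (hz t ht).2.ge⟩

/-- A real `2 × 2` matrix with nonnegative discriminant has two real eigenvalues, whose sum is the
trace and whose product is the determinant. -/
theorem exists_charpoly_roots_eq_pair (A : Matrix (Fin 2) (Fin 2) ℝ)
    (hd : 0 ≤ A.trace ^ 2 - 4 * A.det) :
    ∃ μ₁ μ₂ : ℝ, μ₁ ≤ μ₂ ∧ μ₁ + μ₂ = A.trace ∧ μ₁ * μ₂ = A.det ∧ A.charpoly.roots = {μ₁, μ₂} := by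
  have hsq := Real.sq_sqrt hd
  set r := Real.sqrt (A.trace ^ 2 - 4 * A.det)
  have hr : 0 ≤ r := Real.sqrt_nonneg _
  have hsum : (A.trace - r) / 2 + (A.trace + r) / 2 = A.trace := by ring
  have hprod : (A.trace - r) / 2 * ((A.trace + r) / 2) = A.det := by linear_combination -hsq / 4
  refine ⟨(A.trace - r) / 2, (A.trace + r) / 2, by linarith, hsum, hprod, ?_⟩
  have hfac : A.charpoly = (Multiset.map (fun μ => Polynomial.X - Polynomial.C μ)
      {(A.trace - r) / 2, (A.trace + r) / 2}).prod := by
    rw [Matrix.charpoly_fin_two]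
    nth_rewrite 1 [← hsum]
    rw [← hprod]
    simp only [Multiset.insert_eq_cons, Multiset.map_cons, Multiset.map_singleton,
      Multiset.prod_cons, Multiset.prod_singleton, map_add, map_mul]
    ring
  rw [hfac, Polynomial.roots_multiset_prod_X_sub_C]

theorem exists_charpoly_roots_of_det_neg {A : Matrix (Fin 2) (Fin 2) ℝ} (hdet : A.det < 0) :
    ∃ μ₁ μ₂ : ℝ, μ₁ < 0 ∧ 0 < μ₂ ∧ A.charpoly.roots = {μ₁, μ₂} := by
  obtain ⟨μ₁, μ₂, hle, -, hmul, hroots⟩ := exists_charpoly_roots_eq_pair A (by nlinarith)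
  rcases mul_neg_iff.1 (hmul.trans_lt hdet) with h | h
  · linarith
  · exact ⟨μ₁, μ₂, h.1, h.2, hroots⟩

theorem exists_charpoly_roots_of_trace_neg_of_det_pos {A : Matrix (Fin 2) (Fin 2) ℝ}
    (hd : 0 ≤ A.trace ^ 2 - 4 * A.det) (htr : A.trace < 0) (hdet : 0 < A.det) :
    ∃ μ₁ μ₂ : ℝ, μ₁ < 0 ∧ μ₂ < 0 ∧ A.charpoly.roots = {μ₁, μ₂} := by
  obtain ⟨μ₁, μ₂, hle, hadd, hmul, hroots⟩ := exists_charpoly_roots_eq_pair A hd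
  rcases mul_pos_iff.1 (hdet.trans_eq hmul.symm) with h | h
  · linarith
  · exact ⟨μ₁, μ₂, h.1, h.2, hroots⟩

theorem hasInertia_of_det_neg {A : Matrix (Fin 2) (Fin 2) ℝ} (hdet : A.det < 0) :
    HasInertia A 1 0 1 := by
  obtain ⟨μ₁, μ₂, h₁, h₂, hroots⟩ := exists_charpoly_roots_of_det_neg hdet
  unfold HasInertia
  rw [hroots]
  simp only [Multiset.insert_eq_cons, ← Multiset.cons_zero, Multiset.countP_cons,
    Multiset.countP_zero, h₁, h₂, h₁.ne, h₂.ne', h₁.le.not_gt, h₂.le.not_gt, if_true, if_false]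
  simp

namespace IsSaturation

variable {φ : ℝ → ℝ}

theorem hasDerivAt (hφ : IsSaturation φ) (y : ℝ) : HasDerivAt φ (deriv φ y) y :=
  (hφ.contDiff.differentiable one_ne_zero y).hasDerivAt

theorem continuous_deriv (hφ : IsSaturation φ) : Continuous (deriv φ) :=
  hφ.contDiff.continuous_deriv le_rfl

theorem map_zero (hφ : IsSaturation φ) : φ 0 = 0 := by
  have := hφ.odd 0
  rw [neg_zero] at this
  linarith

theorem deriv_neg (hφ : IsSaturation φ) (y : ℝ) : deriv φ (-y) = deriv φ y := by
  have h : (fun x => φ (-x)) = fun x => -φ x := funext hφ.odd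
  have h' := congrArg (fun f => deriv f y) h
  simp only [deriv_comp_neg, deriv.fun_neg] at h'
  linarith

theorem mul_self_nonneg (hφ : IsSaturation φ) (y : ℝ) : 0 ≤ y * φ y := by
  have hmono : Monotone φ :=
    monotone_of_deriv_nonneg (hφ.contDiff.differentiable one_ne_zero) hφ.deriv_nonneg
  rcases le_total 0 y with h | h
  · exact mul_nonneg h (hφ.map_zero ▸ hmono h)
  · exact mul_nonneg_of_nonpos_of_nonpos h (hφ.map_zero ▸ hmono h)

theorem exists_forall_le_mul_self (hφ : IsSaturation φ) {k : ℝ} (hk : 0 < k) :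
    ∃ D, ∀ y, k * y ^ 2 - D ≤ y * φ y := by
  obtain ⟨r, hr, h⟩ := hφ.dominates k hk
  refine ⟨k * r ^ 2, fun y => ?_⟩
  rcases lt_or_ge r |y| with hy | hy
  · have := h y hy
    have : 0 ≤ k * r ^ 2 := by positivity
    linarith
  · have h1 : y ^ 2 ≤ r ^ 2 := sq_le_sq' (by linarith [neg_abs_le y]) ((le_abs_self y).trans hy)
    have h2 := mul_le_mul_of_nonneg_left h1 hk.le
    have := hφ.mul_self_nonneg y
    linarith

theorem exists_lt_mul_of_deriv_lt (hφ : IsSaturation φ) {κ : ℝ} (hκ : deriv φ 0 < κ) {e : ℝ}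
    (he : 0 < e) : ∃ δ, 0 < δ ∧ δ < e ∧ φ δ < κ * δ := by
  have h1 : ∀ᶠ δ in 𝓝[>] (0 : ℝ), slope φ 0 δ < κ :=
    ((hφ.hasDerivAt 0).tendsto_slope.mono_left
      (nhdsWithin_mono _ fun x hx => ne_of_gt hx)).eventually_lt_const hκ
  obtain ⟨δ, hs, hδ⟩ := (h1.and (Ioo_mem_nhdsGT he)).exists
  refine ⟨δ, hδ.1, hδ.2, ?_⟩
  rwa [slope_def_field, hφ.map_zero, sub_zero, sub_zero, div_lt_iff₀ hδ.1] at hs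

theorem exists_pos_eq_mul (hφ : IsSaturation φ) {κ : ℝ} (hκ : deriv φ 0 < κ) :
    ∃ e, 0 < e ∧ φ e = κ * e := by
  obtain ⟨r, hr, hdom⟩ := hφ.dominates (|κ| + 1) (by positivity)
  obtain ⟨δ, hδ, hδr, hδκ⟩ := hφ.exists_lt_mul_of_deriv_lt hκ hr
  have hpos : κ * (r + 1) < φ (r + 1) := by
    have h1 := hdom (r + 1) (by rw [abs_of_pos] <;> linarith)
    have h2 : 0 < (r + 1) * (φ (r + 1) - (|κ| + 1) * (r + 1)) := by linarith
    have h3 := (mul_pos_iff_of_pos_left (by linarith)).1 h2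
    nlinarith [le_abs_self κ]
  have hc : ContinuousOn (fun y => φ y - κ * y) (Icc δ (r + 1)) :=
    (hφ.contDiff.continuous.sub (continuous_const.mul continuous_id)).continuousOn
  obtain ⟨e, he, he0⟩ := intermediate_value_Icc (by linarith) hc
    (show (0 : ℝ) ∈ Icc _ _ from ⟨by linarith, by linarith⟩)
  exact ⟨e, hδ.trans_le he.1, by simpa [sub_eq_zero] using he0⟩

theorem exists_deriv_eq_add_slope (hφ : IsSaturation φ) (κ : ℝ) {p q : ℝ} (hpq : p < q) :
    ∃ ξ ∈ Ioo p q, (deriv φ ξ - κ) * (q - p) = (φ q - κ * q) - (φ p - κ * p) := by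
  obtain ⟨ξ, hξ, h⟩ := exists_deriv_eq_slope φ hpq hφ.contDiff.continuous.continuousOn
    (hφ.contDiff.differentiable one_ne_zero).differentiableOn
  refine ⟨ξ, hξ, ?_⟩
  have : q - p ≠ 0 := by linarith
  rw [h]
  field_simp
  ring

theorem lt_deriv_of_eq_mul (hφ : IsSaturation φ) (hst : IsStiffening φ) {κ e : ℝ}
    (hκ : deriv φ 0 < κ) (he : 0 < e) (heq : φ e = κ * e) : κ < deriv φ e := by
  obtain ⟨δ, hδ, hδe, hδκ⟩ := hφ.exists_lt_mul_of_deriv_lt hκ he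
  obtain ⟨ξ, hξ, h⟩ := hφ.exists_deriv_eq_add_slope κ hδe
  have h1 : 0 < (deriv φ ξ - κ) * (e - δ) := by linarith
  have h2 := (mul_pos_iff_of_pos_right (by linarith)).1 h1
  have h3 : deriv φ ξ ≤ deriv φ e := hst (hδ.trans hξ.1).le he.le hξ.2.le
  linarith

theorem eq_of_eq_mul (hφ : IsSaturation φ) (hst : IsStiffening φ) {κ e e' : ℝ}
    (hκ : deriv φ 0 < κ) (he : 0 < e) (heq : φ e = κ * e) (he' : 0 < e') (heq' : φ e' = κ * e') :
    e' = e := by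
  wlog hlt : e < e' generalizing e e'
  · rcases (not_lt.1 hlt).lt_or_eq with h | h
    · exact (this he' heq' he heq h).symm
    · exact h
  obtain ⟨ξ, hξ, h⟩ := hφ.exists_deriv_eq_add_slope κ hlt
  have h1 := hφ.lt_deriv_of_eq_mul hst hκ he heq
  have h2 : deriv φ e ≤ deriv φ ξ := hst he.le (he.trans hξ.1).le hξ.1.le
  have h3 : 0 < (deriv φ ξ - κ) * (e' - e) := mul_pos (by linarith) (by linarith)
  linarith

end IsSaturation

/-- The disc `x ^ 2 + y ^ 2 ≤ R` is forward invariant under a planar vector field that points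
strictly inward on its boundary. -/
theorem sq_add_sq_le_of_inward {G : (Fin 2 → ℝ) → (Fin 2 → ℝ)} {γ : ℝ → (Fin 2 → ℝ)} {R : ℝ}
    (hγ : IsTrajectory G γ) (hG : ∀ s, s 0 ^ 2 + s 1 ^ 2 = R → s 0 * G s 0 + s 1 * G s 1 < 0)
    (h0 : γ 0 0 ^ 2 + γ 0 1 ^ 2 ≤ R) {t : ℝ} (ht : 0 ≤ t) : γ t 0 ^ 2 + γ t 1 ^ 2 ≤ R := by
  have hd : ∀ t ∈ Ici (0 : ℝ), HasDerivWithinAt (fun t => γ t 0 ^ 2 + γ t 1 ^ 2)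
      (2 * (γ t 0 * G (γ t) 0 + γ t 1 * G (γ t) 1)) (Ici 0) t := by
    intro t ht
    have hc := hasDerivWithinAt_pi.1 (hγ t ht)
    refine (((hc 0).fun_pow 2).add ((hc 1).fun_pow 2)).congr_deriv ?_
    push_cast
    ring
  refine image_le_of_deriv_right_lt_deriv_boundary' (a := 0) (b := t)
    (f := fun t => γ t 0 ^ 2 + γ t 1 ^ 2) (B := fun _ => R) (B' := fun _ => 0)
    (fun s hs => ((hd s hs.1).mono Icc_subset_Ici_self).continuousWithinAt)
    (fun s hs => (hd s hs.1).mono (Ici_subset_Ici.2 hs.1)) h0 continuousOn_const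
    (fun s _ => hasDerivWithinAt_const _ _ _) (fun s _ hs => ?_) ⟨ht, le_rfl⟩
  have := hG (γ s) hs
  linarith

namespace Params

variable (c : Params) {φ : ℝ → ℝ}

theorem a_pos : 0 < c.a := by
  have := c.R₁_pos; have := c.Ra_pos; have := c.C₁_pos
  unfold a; positivity

theorem b_pos : 0 < c.b := by
  have := c.Ra_pos; have := c.C₁_pos
  unfold b; positivity

/-- The slope of the line that meets the graph of the nonlinearity at the equilibria of the
unforced circuit. -/
noncomputable def loadSlope : ℝ := -(1 / c.R₀) + c.α * c.R₁ / (c.R₁ + c.Ra)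

theorem loadSlope_eq : c.loadSlope = -(1 / c.R₀) + c.α * (c.b / c.a) := by
  have := c.R₁_pos; have := c.Ra_pos; have := c.C₁_pos
  have : c.R₁ + c.Ra ≠ 0 := by positivity
  unfold loadSlope a b
  field_simp

/-- The Jacobian matrix of the closed loop. -/
noncomputable def jac (φ : ℝ → ℝ) (s : Fin 2 → ℝ) : Matrix (Fin 2) (Fin 2) ℝ :=
  !![-(1 / (c.R₀ * c.C₀)) - 1 / c.C₀ * deriv φ (s 0), c.α / c.C₀; c.b, -c.a]

theorem hasFDerivAt_closedLoop_f (hφ : IsSaturation φ) (s : Fin 2 → ℝ) :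
    HasFDerivAt (c.closedLoop φ).f (Matrix.toLin' (c.jac φ s)).toContinuousLinearMap s := by
  have h0 : HasFDerivAt (fun s : Fin 2 → ℝ => s 0) (ContinuousLinearMap.proj 0) s :=
    hasFDerivAt_apply (𝕜 := ℝ) 0 s
  have h1 : HasFDerivAt (fun s : Fin 2 → ℝ => s 1) (ContinuousLinearMap.proj 1) s :=
    hasFDerivAt_apply (𝕜 := ℝ) 1 s
  rw [hasFDerivAt_pi']
  intro i
  fin_cases i
  · refine (((h0.const_mul (-(1 / (c.R₀ * c.C₀)))).sub
      (((hφ.hasDerivAt (s 0)).comp_hasFDerivAt s h0).const_mul (1 / c.C₀))).add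
      (h1.const_mul (c.α / c.C₀))).congr_fderiv ?_
    ext v
    simp [jac, dotProduct, Fin.sum_univ_two]
    ring
  · refine ((h1.const_mul (-c.a)).add (h0.const_mul c.b)).congr_fderiv ?_
    ext v
    simp [jac, dotProduct, Fin.sum_univ_two]
    ring

theorem hasFDerivAt_field (hφ : IsSaturation φ) (Vr : ℝ) (s : Fin 2 → ℝ) :
    HasFDerivAt ((c.closedLoop φ).field ![Vr])
      (Matrix.toLin' (c.jac φ s)).toContinuousLinearMap s :=
  (c.hasFDerivAt_closedLoop_f hφ s).add_const _

theorem jacobian_closedLoop_f (hφ : IsSaturation φ) (s : Fin 2 → ℝ) :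
    jacobian (c.closedLoop φ).f s = c.jac φ s := by
  unfold jacobian
  rw [(c.hasFDerivAt_closedLoop_f hφ s).fderiv]
  exact LinearMap.toMatrix'_toLin' _

theorem jacobian_field (hφ : IsSaturation φ) (Vr : ℝ) (s : Fin 2 → ℝ) :
    jacobian ((c.closedLoop φ).field ![Vr]) s = c.jac φ s := by
  unfold jacobian
  rw [(c.hasFDerivAt_field hφ Vr s).fderiv]
  exact LinearMap.toMatrix'_toLin' _

theorem det_jac (φ : ℝ → ℝ) (s : Fin 2 → ℝ) :
    (c.jac φ s).det = c.a / c.C₀ * (deriv φ (s 0) - c.loadSlope) := by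
  have := c.R₀_pos; have := c.C₀_pos; have := c.a_pos
  rw [loadSlope_eq, jac, Matrix.det_fin_two_of]
  field_simp
  ring

theorem trace_jac (φ : ℝ → ℝ) (s : Fin 2 → ℝ) :
    (c.jac φ s).trace = -(1 / (c.R₀ * c.C₀)) - 1 / c.C₀ * deriv φ (s 0) - c.a := by
  rw [jac, Matrix.trace_fin_two_of]
  ring

theorem discrim_jac_nonneg (φ : ℝ → ℝ) (s : Fin 2 → ℝ) :
    0 ≤ (c.jac φ s).trace ^ 2 - 4 * (c.jac φ s).det := by
  have := c.C₀_pos; have := c.α_pos; have := c.b_pos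
  have h : (c.jac φ s).trace ^ 2 - 4 * (c.jac φ s).det =
      (-(1 / (c.R₀ * c.C₀)) - 1 / c.C₀ * deriv φ (s 0) + c.a) ^ 2 + 4 * (c.α / c.C₀ * c.b) := by
    rw [trace_jac, jac, Matrix.det_fin_two_of]
    ring
  rw [h]
  positivity

theorem isSaddle_of_deriv_lt (hφ : IsSaturation φ) {Vr : ℝ} {s : Fin 2 → ℝ}
    (hs : (c.closedLoop φ).field ![Vr] s = 0) (h : deriv φ (s 0) < c.loadSlope) :
    IsSaddle ((c.closedLoop φ).field ![Vr]) s := by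
  refine ⟨hs, (c.hasFDerivAt_field hφ Vr s).differentiableAt, ?_⟩
  rw [c.jacobian_field hφ]
  refine exists_charpoly_roots_of_det_neg ?_
  rw [det_jac]
  exact mul_neg_of_pos_of_neg (div_pos c.a_pos c.C₀_pos) (by linarith)

theorem isStableNode_of_lt_deriv (hφ : IsSaturation φ) {Vr : ℝ} {s : Fin 2 → ℝ}
    (hs : (c.closedLoop φ).field ![Vr] s = 0) (h : c.loadSlope < deriv φ (s 0)) :
    IsStableNode ((c.closedLoop φ).field ![Vr]) s := by
  refine ⟨hs, (c.hasFDerivAt_field hφ Vr s).differentiableAt, ?_⟩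
  rw [c.jacobian_field hφ]
  refine exists_charpoly_roots_of_trace_neg_of_det_pos (c.discrim_jac_nonneg φ s) ?_ ?_
  · have := c.R₀_pos; have := c.C₀_pos; have := c.a_pos; have := hφ.deriv_nonneg (s 0)
    have h1 : 0 < 1 / (c.R₀ * c.C₀) := by positivity
    have h2 : 0 ≤ 1 / c.C₀ * deriv φ (s 0) := by positivity
    rw [trace_jac]
    linarith
  · rw [det_jac]
    exact mul_pos (div_pos c.a_pos c.C₀_pos) (by linarith)

/-- The closed loop is strictly `1`-passive, with a diagonal storage. -/
theorem isStrictlyPassive_closedLoop (hφ : IsSaturation φ) {lam : ℝ} (h₁ : c.a < lam)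
    (h₂ : lam < 1 / (c.R₀ * c.C₀)) : (c.closedLoop φ).IsStrictlyPassive 1 lam := by
  have hC := c.C₀_pos; have hα := c.α_pos; have ha := c.a_pos; have hb := c.b_pos
  set ε := min (2 * (c.C₀ / c.α) * (1 / (c.R₀ * c.C₀) - lam)) (2 * (1 / c.b) * (lam - c.a))
  have hε₁ : ε ≤ 2 * (c.C₀ / c.α) * (1 / (c.R₀ * c.C₀) - lam) := min_le_left _ _
  have hε₂ : ε ≤ 2 * (1 / c.b) * (lam - c.a) := min_le_right _ _
  have hεpos : 0 < ε := lt_min (mul_pos (by positivity) (by linarith))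
    (mul_pos (by positivity) (by linarith))
  refine ⟨by linarith, fun s => (c.hasFDerivAt_closedLoop_f hφ s).differentiableAt,
    !![c.C₀ / c.α, 0; 0, -(1 / c.b)], ε, ?_, ?_, hεpos, ?_⟩
  · ext i j
    fin_cases i <;> fin_cases j <;> simp
  · refine hasInertia_of_det_neg ?_
    rw [Matrix.det_fin_two_of]
    have : 0 < c.C₀ / c.α * (1 / c.b) := by positivity
    linarith
  · intro s v w
    rw [c.jacobian_closedLoop_f hφ]
    have key : blockForm (Matrix.fromBlocks 0 !![c.C₀ / c.α, 0; 0, -(1 / c.b)]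
          !![c.C₀ / c.α, 0; 0, -(1 / c.b)]
          ((2 * lam) • !![c.C₀ / c.α, 0; 0, -(1 / c.b)] + ε • (1 : Matrix (Fin 2) (Fin 2) ℝ)))
          ((c.jac φ s).mulVec v + (c.closedLoop φ).B.mulVec w) v =
        (2 * (c.C₀ / c.α) * (lam - 1 / (c.R₀ * c.C₀)) + ε) * v 0 ^ 2
          - 2 / c.α * deriv φ (s 0) * v 0 ^ 2
          + (ε - 2 * (1 / c.b) * (lam - c.a)) * v 1 ^ 2 + 2 * v 0 * w 0 := by
      simp [blockForm, jac, closedLoop, Matrix.mulVec, dotProduct, Fin.sum_univ_two]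
      field_simp
      ring
    have key' : blockForm (Matrix.fromBlocks 0 1 1 0) ((c.closedLoop φ).C.mulVec v) w =
        2 * v 0 * w 0 := by
      simp [blockForm, closedLoop, Matrix.mulVec, dotProduct, Fin.sum_univ_two]
      ring
    rw [key, key']
    have hd := hφ.deriv_nonneg (s 0)
    have t₁ : (2 * (c.C₀ / c.α) * (lam - 1 / (c.R₀ * c.C₀)) + ε) * v 0 ^ 2 ≤ 0 :=
      mul_nonpos_of_nonpos_of_nonneg (by linarith) (sq_nonneg _)
    have t₂ : 0 ≤ 2 / c.α * deriv φ (s 0) * v 0 ^ 2 := by positivity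
    have t₃ : (ε - 2 * (1 / c.b) * (lam - c.a)) * v 1 ^ 2 ≤ 0 :=
      mul_nonpos_of_nonpos_of_nonneg (by linarith) (sq_nonneg _)
    linarith

theorem field_zero (φ : ℝ → ℝ) (Vr : ℝ) (s : Fin 2 → ℝ) :
    (c.closedLoop φ).field ![Vr] s 0 = c.opAmpRate φ (s 0) (s 1 + Vr) := by
  rw [closedLoop_field]; rfl

theorem field_one (φ : ℝ → ℝ) (Vr : ℝ) (s : Fin 2 → ℝ) :
    (c.closedLoop φ).field ![Vr] s 1 = c.networkRate (s 1) (s 0) := by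
  rw [closedLoop_field]; rfl

/-- The closed loop is dissipative: outside a large disc, its field points inward. -/
theorem exists_inner_field_le (hφ : IsSaturation φ) (Vr : ℝ) :
    ∃ D, ∀ s, s 0 * (c.closedLoop φ).field ![Vr] s 0 + s 1 * (c.closedLoop φ).field ![Vr] s 1 ≤
      -(c.a / 2) * (s 0 ^ 2 + s 1 ^ 2) + D := by
  have hC := c.C₀_pos; have hR := c.R₀_pos; have hα := c.α_pos; have ha := c.a_pos
  have hb := c.b_pos
  set k := c.α / c.C₀ with hk
  set K := (k + c.b) ^ 2 / (2 * c.a) + c.a / 2 + 1 / 2 with hK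
  have hKpos : 0 < K := by positivity
  obtain ⟨D, hD⟩ := hφ.exists_forall_le_mul_self (mul_pos hC hKpos)
  refine ⟨D / c.C₀ + (k * Vr) ^ 2 / 2, fun s => ?_⟩
  rw [field_zero, field_one, opAmpRate, networkRate, ← hk]
  set x := s 0
  set z := s 1
  have h1 : K * x ^ 2 - D / c.C₀ ≤ 1 / c.C₀ * (x * φ x) := by
    have := mul_le_mul_of_nonneg_left (hD x) (one_div_pos.2 hC).le
    refine le_trans (le_of_eq ?_) this
    field_simp
  have h2 : (k + c.b) * (x * z) ≤ c.a / 2 * z ^ 2 + (k + c.b) ^ 2 / (2 * c.a) * x ^ 2 := by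
    have : c.a / 2 * z ^ 2 + (k + c.b) ^ 2 / (2 * c.a) * x ^ 2 - (k + c.b) * (x * z) =
        (c.a * z - (k + c.b) * x) ^ 2 / (2 * c.a) := by
      field_simp
      ring
    have h0 : 0 ≤ (c.a * z - (k + c.b) * x) ^ 2 / (2 * c.a) := by positivity
    linarith
  have h3 : k * Vr * x ≤ x ^ 2 / 2 + (k * Vr) ^ 2 / 2 := by nlinarith [sq_nonneg (k * Vr - x)]
  have h4 : 0 ≤ 1 / (c.R₀ * c.C₀) * x ^ 2 := by positivity
  have h5 : K * x ^ 2 = (k + c.b) ^ 2 / (2 * c.a) * x ^ 2 + c.a / 2 * x ^ 2 + x ^ 2 / 2 := by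
    rw [hK]; ring
  linarith

theorem exists_inward_radius (hφ : IsSaturation φ) (Vr : ℝ) (s₀ : Fin 2 → ℝ) :
    ∃ R, s₀ 0 ^ 2 + s₀ 1 ^ 2 ≤ R ∧ ∀ s, s 0 ^ 2 + s 1 ^ 2 = R →
      s 0 * (c.closedLoop φ).field ![Vr] s 0 + s 1 * (c.closedLoop φ).field ![Vr] s 1 < 0 := by
  obtain ⟨D, hD⟩ := c.exists_inner_field_le hφ Vr
  have ha := c.a_pos
  refine ⟨max (s₀ 0 ^ 2 + s₀ 1 ^ 2) (2 * D / c.a + 1), le_max_left _ _, fun s hs => ?_⟩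
  have h1 : 2 * D / c.a + 1 ≤ s 0 ^ 2 + s 1 ^ 2 := hs ▸ le_max_right _ _
  have h2 := mul_le_mul_of_nonneg_left h1 (half_pos ha).le
  have h3 : c.a / 2 * (2 * D / c.a + 1) = D + c.a / 2 := by field_simp
  linarith [hD s]

theorem contDiff_field (hφ : IsSaturation φ) (Vr : ℝ) :
    ContDiff ℝ 1 ((c.closedLoop φ).field ![Vr]) := by
  have hφ' := hφ.contDiff
  rw [contDiff_pi]
  intro i
  fin_cases i
  · simp only [Fin.zero_eta, field_zero, opAmpRate]
    fun_prop
  · simp only [Fin.mk_one, field_one, networkRate]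
    fun_prop

/-- Every initial condition of the closed loop has a trajectory on `[0, ∞)`. -/
theorem exists_isTrajectory (hφ : IsSaturation φ) (Vr : ℝ) (s₀ : Fin 2 → ℝ) :
    ∃ γ : ℝ → (Fin 2 → ℝ), γ 0 = s₀ ∧ IsTrajectory ((c.closedLoop φ).field ![Vr]) γ := by
  obtain ⟨R, hR, hin⟩ := c.exists_inward_radius hφ Vr s₀
  have hR0 : 0 ≤ R := le_trans (by positivity) hR
  set F := (c.closedLoop φ).field ![Vr] with hF
  set M := R + 1 with hM
  have hM0 : 0 ≤ M := by linarith
  let clamp : (Fin 2 → ℝ) → (Fin 2 → ℝ) := fun s i => max (-M) (min M (s i))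
  have hclamp_lip : LipschitzWith 1 clamp := by
    refine LipschitzWith.of_dist_le_mul fun s t => ?_
    rw [NNReal.coe_one, one_mul, dist_pi_le_iff dist_nonneg]
    intro i
    have h1 : LipschitzWith 1 fun y : ℝ => max (-M) (min M y) :=
      (LipschitzWith.id.const_min M).const_max (-M)
    have h2 := h1.dist_le_mul (s i) (t i)
    rw [NNReal.coe_one, one_mul] at h2
    exact h2.trans (dist_le_pi_dist s t i)
  have hclamp_mem : ∀ s, clamp s ∈ Metric.closedBall (0 : Fin 2 → ℝ) M := by
    intro s
    rw [mem_closedBall_zero_iff, pi_norm_le_iff_of_nonneg hM0]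
    intro i
    exact abs_le.2 ⟨le_max_left _ _, max_le (by linarith) (min_le_left _ _)⟩
  have hclamp_id : ∀ s, s 0 ^ 2 + s 1 ^ 2 ≤ R → clamp s = s := by
    intro s hs
    ext i
    have hi : s i ^ 2 ≤ R := by
      fin_cases i
      · exact le_trans (le_add_of_nonneg_right (sq_nonneg _)) hs
      · exact le_trans (le_add_of_nonneg_left (sq_nonneg _)) hs
    have h1 := abs_le.1 (abs_le_of_sq_le_sq (show s i ^ 2 ≤ M ^ 2 by nlinarith) hM0)
    exact (congrArg _ (min_eq_right h1.2)).trans (max_eq_right h1.1)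
  obtain ⟨K, hK⟩ := (c.contDiff_field hφ Vr).contDiffOn.exists_lipschitzOnWith one_ne_zero
    (convex_closedBall (0 : Fin 2 → ℝ) M) (isCompact_closedBall _ _)
  obtain ⟨L, hL⟩ := (isCompact_closedBall (0 : Fin 2 → ℝ) M).exists_bound_of_continuousOn
    (c.contDiff_field hφ Vr).continuous.continuousOn
  have hG : LipschitzWith (K * 1) fun s => F (clamp s) :=
    lipschitzOnWith_univ.1 (hK.comp hclamp_lip.lipschitzOnWith fun s _ => hclamp_mem s)
  obtain ⟨γ, hγ0, hγ⟩ := exists_isIntegralCurveOn_Ici hG (L := L.toNNReal)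
    (fun s => (hL _ (hclamp_mem s)).trans (Real.le_coe_toNNReal L)) s₀
  refine ⟨γ, hγ0, fun t ht => ?_⟩
  have hbound := sq_add_sq_le_of_inward (R := R) hγ
    (fun s hs => by simpa only [hclamp_id s hs.le] using hin s hs) (by rwa [hγ0]) ht
  have := hγ t ht
  simpa only [hclamp_id _ hbound] using this

/-- Every trajectory of the closed loop converges to a fixed point. -/
theorem exists_tendsto_of_isTrajectory (hφ : IsSaturation φ) {Vr : ℝ} {γ : ℝ → (Fin 2 → ℝ)}
    (hγ : IsTrajectory ((c.closedLoop φ).field ![Vr]) γ) :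
    ∃ e, (c.closedLoop φ).field ![Vr] e = 0 ∧ Tendsto γ atTop (𝓝 e) := by
  obtain ⟨R, hR, hin⟩ := c.exists_inward_radius hφ Vr (γ 0)
  have hbound : ∀ t, 0 ≤ t → γ t 0 ^ 2 + γ t 1 ^ 2 ≤ R :=
    fun t ht => sq_add_sq_le_of_inward hγ hin hR ht
  have habs : ∀ i t, 0 ≤ t → |γ t i| ≤ Real.sqrt R := by
    intro i t ht
    refine Real.abs_le_sqrt (le_trans ?_ (hbound t ht))
    fin_cases i
    · exact le_add_of_nonneg_right (sq_nonneg _)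
    · exact le_add_of_nonneg_left (sq_nonneg _)
  have hd : ∀ i, ∀ t ∈ Ici (0 : ℝ), HasDerivWithinAt (fun t => γ t i)
      ((c.closedLoop φ).field ![Vr] (γ t) i) (Ici 0) t :=
    fun i t ht => hasDerivWithinAt_pi.1 (hγ t ht) i
  have hd0 := hd 0
  have hd1 := hd 1
  simp only [field_zero, field_one] at hd0 hd1
  obtain ⟨t₀, ht₀, hu, hv⟩ := exists_eventually_sign_of_cooperative
    (u := fun t => c.opAmpRate φ (γ t 0) (γ t 1 + Vr)) (v := fun t => c.networkRate (γ t 1) (γ t 0))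
    (p := fun t => 1 / (c.R₀ * c.C₀) + 1 / c.C₀ * deriv φ (γ t 0)) (a := c.a) c.b_pos
    (div_pos c.α_pos c.C₀_pos)
    (continuousOn_const.add (continuousOn_const.mul (hφ.continuous_deriv.comp_continuousOn
      fun t ht => (hd0 t ht).continuousWithinAt)))
    (fun t ht => by
      refine ((((hd0 t ht).const_mul (-(1 / (c.R₀ * c.C₀)))).sub
        (((hφ.hasDerivAt (γ t 0)).comp_hasDerivWithinAt t (hd0 t ht)).const_mul (1 / c.C₀))).add
        (((hd1 t ht).add_const Vr).const_mul (c.α / c.C₀))).congr_deriv ?_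
      ring)
    (fun t ht => ((hd1 t ht).const_mul (-c.a)).add ((hd0 t ht).const_mul c.b))
  obtain ⟨x, hx⟩ := exists_tendsto_of_deriv_sign ht₀ hd0 (habs 0) hu
  obtain ⟨z, hz⟩ := exists_tendsto_of_deriv_sign ht₀ hd1 (habs 1) hv
  have hlim : Tendsto γ atTop (𝓝 ![x, z]) := by
    rw [tendsto_pi_nhds]
    intro i
    fin_cases i
    · exact hx
    · exact hz
  refine ⟨![x, z], ?_, hlim⟩
  have hF : Tendsto (fun t => (c.closedLoop φ).field ![Vr] (γ t)) atTop
      (𝓝 ((c.closedLoop φ).field ![Vr] ![x, z])) :=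
    ((c.contDiff_field hφ Vr).continuous.tendsto _).comp hlim
  ext i
  exact eq_zero_of_tendsto_of_tendsto_deriv (hd i) ((tendsto_pi_nhds.1 hlim) i)
    ((tendsto_pi_nhds.1 hF) i)

theorem field_zero_input_eq_zero_iff (φ : ℝ → ℝ) (s : Fin 2 → ℝ) :
    (c.closedLoop φ).field ![0] s = 0 ↔ s 1 = c.b / c.a * s 0 ∧ φ (s 0) = c.loadSlope * s 0 := by
  have hC := c.C₀_pos; have hR := c.R₀_pos; have ha := c.a_pos
  rw [funext_iff, Fin.forall_fin_two, field_zero, field_one, opAmpRate, networkRate, add_zero,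
    Pi.zero_apply, Pi.zero_apply, loadSlope_eq]
  have h1 : -c.a * s 1 + c.b * s 0 = 0 ↔ s 1 = c.b / c.a * s 0 := by
    rw [div_mul_eq_mul_div, eq_div_iff ha.ne']
    constructor <;> intro h <;> linarith
  rw [and_comm, h1]
  refine and_congr_right fun h => ?_
  rw [h]
  have h2 : -(1 / (c.R₀ * c.C₀)) * s 0 - 1 / c.C₀ * φ (s 0) + c.α / c.C₀ * (c.b / c.a * s 0) =
      1 / c.C₀ * ((-(1 / c.R₀) + c.α * (c.b / c.a)) * s 0 - φ (s 0)) := by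
    field_simp
    ring
  rw [h2, mul_eq_zero, or_iff_right (one_div_pos.2 hC).ne', sub_eq_zero, eq_comm]

/-- The equilibrium of the unforced closed loop with output `x`, if there is one. -/
noncomputable def equilibrium (x : ℝ) : Fin 2 → ℝ := ![x, c.b / c.a * x]

theorem field_equilibrium {x : ℝ} (hx : φ x = c.loadSlope * x) :
    (c.closedLoop φ).field ![0] (c.equilibrium x) = 0 :=
  (c.field_zero_input_eq_zero_iff φ _).2 ⟨rfl, hx⟩

theorem eq_equilibrium_of_field_eq_zero {s : Fin 2 → ℝ}
    (hs : (c.closedLoop φ).field ![0] s = 0) :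
    s = c.equilibrium (s 0) ∧ φ (s 0) = c.loadSlope * s 0 := by
  obtain ⟨h1, h2⟩ := (c.field_zero_input_eq_zero_iff φ s).1 hs
  refine ⟨?_, h2⟩
  ext i
  fin_cases i
  · rfl
  · exact h1

theorem equilibrium_neg (x : ℝ) : c.equilibrium (-x) = -c.equilibrium x := by
  ext i
  fin_cases i <;> simp [equilibrium]

theorem equilibrium_zero : c.equilibrium 0 = 0 := by
  ext i
  fin_cases i <;> simp [equilibrium]

theorem equilibrium_injective : Function.Injective c.equilibrium :=
  fun _ _ h => congrFun h 0

theorem isBistable_of_isStiffening (hφ : IsSaturation φ) (hst : IsStiffening φ)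
    (h0 : deriv φ 0 < c.loadSlope) : IsBistable ((c.closedLoop φ).field ![0]) := by
  obtain ⟨e, he, heq⟩ := hφ.exists_pos_eq_mul h0
  have heq' : φ (-e) = c.loadSlope * -e := by rw [hφ.odd, heq]; ring
  have hz : φ 0 = c.loadSlope * 0 := by rw [hφ.map_zero, mul_zero]
  have hslope := hφ.lt_deriv_of_eq_mul hst h0 he heq
  refine ⟨c.equilibrium e, c.equilibrium (-e), c.equilibrium 0,
    c.equilibrium_injective.ne (by linarith), c.equilibrium_injective.ne he.ne',
    c.equilibrium_injective.ne (by linarith), ?_,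
    c.isStableNode_of_lt_deriv hφ (c.field_equilibrium heq) hslope,
    c.isStableNode_of_lt_deriv hφ (c.field_equilibrium heq') ((hφ.deriv_neg e).symm ▸ hslope),
    c.isSaddle_of_deriv_lt hφ (c.field_equilibrium hz) h0⟩
  ext s
  simp only [mem_ofPred_eq, mem_insert_iff, mem_singleton_iff]
  constructor
  · intro hs
    obtain ⟨hs1, hs2⟩ := c.eq_equilibrium_of_field_eq_zero hs
    rcases lt_trichotomy (s 0) 0 with h | h | h
    · have h3 : -s 0 = e := hφ.eq_of_eq_mul hst h0 he heq (neg_pos.2 h) (by rw [hφ.odd, hs2]; ring)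
      exact .inr (.inl (by rw [hs1, ← h3, neg_neg]))
    · exact .inr (.inr (by rw [hs1, h]))
    · exact .inl (by rw [hs1, hφ.eq_of_eq_mul hst h0 he heq h hs2])
  · rintro (rfl | rfl | rfl)
    · exact c.field_equilibrium heq
    · exact c.field_equilibrium heq'
    · exact c.field_equilibrium hz

end Params

end OpAmp

theorem mainTheorem4 (c : OpAmp.Params) (φ : ℝ → ℝ) (hφ : OpAmp.IsSaturation φ)
    (hfast : c.a < 1 / (c.R₀ * c.C₀)) :
    -- strict 1-passivity from `V_r` to `V₀`, with every rate in the interval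
    (∀ lam ∈ Set.Ioo c.a (1 / (c.R₀ * c.C₀)), (c.closedLoop φ).IsStrictlyPassive 1 lam) ∧
    -- for every constant input, trajectories exist for all forward time, and each one converges
    -- to a fixed point
    (∀ Vr : ℝ,
      (∀ s₀ : Fin 2 → ℝ, ∃ γ : ℝ → (Fin 2 → ℝ), γ 0 = s₀ ∧
        OpAmp.IsTrajectory ((c.closedLoop φ).field ![Vr]) γ) ∧
      (∀ γ : ℝ → (Fin 2 → ℝ), OpAmp.IsTrajectory ((c.closedLoop φ).field ![Vr]) γ →
        ∃ e : Fin 2 → ℝ, (c.closedLoop φ).field ![Vr] e = 0 ∧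
          Filter.Tendsto γ Filter.atTop (nhds e))) ∧
    -- with `V_r = 0`, under the slope condition at the origin
    (deriv φ 0 < -(1 / c.R₀) + c.α * c.R₁ / (c.R₁ + c.Ra) →
      OpAmp.IsSaddle ((c.closedLoop φ).field ![0]) 0 ∧
      (∃ e : Fin 2 → ℝ, e ≠ 0 ∧ (c.closedLoop φ).field ![0] e = 0 ∧
        (c.closedLoop φ).field ![0] (-e) = 0) ∧
      (OpAmp.IsStiffening φ → OpAmp.IsBistable ((c.closedLoop φ).field ![0]))) := by
  refine ⟨fun lam hlam => c.isStrictlyPassive_closedLoop hφ hlam.1 hlam.2,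
    fun Vr => ⟨c.exists_isTrajectory hφ Vr, fun γ hγ => c.exists_tendsto_of_isTrajectory hφ hγ⟩,
    fun h0 => ⟨?_, ?_, fun hst => c.isBistable_of_isStiffening hφ hst h0⟩⟩
  · refine c.isSaddle_of_deriv_lt hφ ?_ h0
    exact (c.field_zero_input_eq_zero_iff φ 0).2 ⟨by simp, by simp [hφ.map_zero]⟩
  · obtain ⟨e, he, heq⟩ := hφ.exists_pos_eq_mul h0
    refine ⟨c.equilibrium e, ?_, c.field_equilibrium heq, ?_⟩
    · rw [← c.equilibrium_zero]
      exact c.equilibrium_injective.ne he.ne'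
    · rw [← c.equilibrium_neg]
      exact c.field_equilibrium (by rw [hφ.odd, heq, OpAmp.Params.loadSlope]; ring)
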